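/- Banach spaces are over $\mathbb{K}=\mathbb{R}$ or $\mathbb{C}$, and $B_Z$ denotes the closed unit ball of a Banach space $Z$. A Banach space $Z$ is *strongly weakly compactly generated* (SWCG) if there is a weakly compact set $G\subseteq Z$ such that for every weakly compact set $K\subseteq Z$ and every $\varepsilon>0$ there is $n\in\mathbb{N}$ with $K\subseteq nG+\varepsilon B_Z$. An *unconditional Schauder decomposition* of $Z$ is a family $(Z_i)_{i\in I}$ of closed linear subspaces such that each $z\in Z$ can be written in a unique way as $z=\sum_{i\in I}z_i$ with $z_i\in Z_i$ for all $i\in I$ and the series unconditionally convergent; put $P_i(z)=z_i$, and $P_C=\sum_{i\in C}P_i$ for finite $C\subseteq I$. It is *finite-dimensional* if every $Z_i$ is finite-dimensional, and *countable* if $I$ is countable (finite or infinite). For $1<p<\infty$, it has a *disjoint lower $p$-estimate* if there is a constant $c>0$ such that for every finite collection $C_1,\dots,C_r$ of pairwise disjoint finite subsets of $I$ and every $z\in Z$, $$\Big(\sum_{k=1}^r\|P_{C_k}(z)\|^p\Big)^{1/p}\le c\,\|z\|.$$ The *projective tensor product* $X\widehat{\otimes}_\pi Y$ of Banach spaces $X$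 and $Y$ is the completion of the algebraic tensor product $X\otimes Y$ with respect to the norm $\|z\|=\sup|S(z)|$, the supremum being over all continuous bilinear functionals $S$ on $X\times Y$ with $\|S\|\le 1$ (regarded as linear functionals on $X\otimes Y$). **Theorem 1.1.** Let $1<p,q<\infty$ with $1/p+1/q\ge 1$. Let $X$ be a Banach space with a countable unconditional finite-dimensional Schauder decomposition having a disjoint lower $p$-estimate, and let $Y$ be a Banach space (over the same field) with a countable unconditional finite-dimensional Schauder decomposition having a disjoint lower $q$-estimate. If $X$ and $Y$ are SWCG, then $X\widehat{\otimes}_\pi Y$ is SWCG. -/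

import Mathlib

open scoped TensorProduct Pointwise

noncomputable section

/-! ## Strongly weakly compactly generated spaces -/

section SWCG

variable (𝕜 : Type*) [RCLike 𝕜] {E : Type*} [NormedAddCommGroup E] [NormedSpace 𝕜 E]

/-- A subset of `E` is weakly compact if it is compact for the weak topology of `E`. -/
def IsWeaklyCompact (K : Set E) : Prop :=
  IsCompact (toWeakSpace 𝕜 E '' K)

variable (E) in
/-- `E` is strongly weakly compactly generated (SWCG): there is a weakly compact set `G` such that
every weakly compact set `K` is, for every `ε > 0`, contained in `n G + ε B_E` for some natural
number `n`. Here `n G` is the dilate `{n x : x ∈ G}`, and `ε B_E` is the closed ball of radius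
`ε` around `0`. -/
def IsSWCG : Prop :=
  ∃ G : Set E, IsWeaklyCompact 𝕜 G ∧
    ∀ K : Set E, IsWeaklyCompact 𝕜 K → ∀ ε : ℝ, 0 < ε →
      ∃ n : ℕ, K ⊆ (n : 𝕜) • G + Metric.closedBall (0 : E) ε

end SWCG

/-! ## Unconditional Schauder decompositions -/

section Decomposition

variable {𝕜 : Type*} [RCLike 𝕜] {X : Type*} [NormedAddCommGroup X] [NormedSpace 𝕜 X]
  {I : Type*}

/-- An unconditional Schauder decomposition of `X`: a family of closed linear subspaces `V i` such
that every `x` is in a unique way the sum of an unconditionally convergent series `∑ i, f i` with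
`f i ∈ V i`. (`HasSum` is convergence of the net of finite partial sums, that is, unconditional
convergence.) -/
structure IsUnconditionalSchauderDecomposition (V : I → Submodule 𝕜 X) : Prop where
  isClosed : ∀ i, IsClosed (V i : Set X)
  existsUnique_hasSum : ∀ x : X, ∃! f : ∀ i, V i, HasSum (fun i => (f i : X)) x

namespace IsUnconditionalSchauderDecomposition

variable {V : I → Submodule 𝕜 X} (hV : IsUnconditionalSchauderDecomposition V)

/-- The components of `x` with respect to the decomposition. -/
def component (x : X) : ∀ i, V i := (hV.existsUnique_hasSum x).choose

theorem hasSum_component (x : X) : HasSum (fun i => (hV.component x i : X)) x :=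
  (hV.existsUnique_hasSum x).choose_spec.1

theorem component_eq {x : X} {f : ∀ i, V i} (hf : HasSum (fun i => (f i : X)) x) :
    hV.component x = f :=
  ((hV.existsUnique_hasSum x).choose_spec.2 f hf).symm

/-- The projection `P_i` of `X` onto `V i`, so that `x = ∑ i, P_i x` for every `x`. -/
def proj (i : I) : X →ₗ[𝕜] X where
  toFun x := hV.component x i
  map_add' x y := by
    have h := (hV.hasSum_component x).add (hV.hasSum_component y)
    rw [hV.component_eq (f := fun i => hV.component x i + hV.component y i) (by simpa using h)]
    simp
  map_smul' a x := by
    have h := (hV.hasSum_component x).const_smul a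
    rw [hV.component_eq (f := fun i => a • hV.component x i) (by simpa using h)]
    simp

/-- The projection `P_C = ∑ i ∈ C, P_i` for a finite set `C` of indices. -/
def projFinset (C : Finset I) : X →ₗ[𝕜] X := ∑ i ∈ C, hV.proj i

/-- The decomposition has a disjoint lower `p`-estimate: for some constant `c > 0`, all finite
collections `C_1, …, C_r` of pairwise disjoint finite sets of indices and all `x`,
`(∑ k, ‖P_{C_k} x‖ ^ p) ^ (1 / p) ≤ c ‖x‖`. -/
def HasDisjointLowerEstimate (p : ℝ) : Prop :=
  ∃ c : ℝ, 0 < c ∧ ∀ (r : ℕ) (C : Fin r → Finset I),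
    (Pairwise fun k l => Disjoint (C k) (C l)) →
      ∀ x : X, (∑ k, ‖hV.projFinset (C k) x‖ ^ p) ^ (1 / p) ≤ c * ‖x‖

end IsUnconditionalSchauderDecomposition

end Decomposition

/-! ## The projective tensor product -/

section ProjectiveTensorProduct

variable (𝕜 : Type*) [RCLike 𝕜]
  (X : Type*) [NormedAddCommGroup X] [NormedSpace 𝕜 X]
  (Y : Type*) [NormedAddCommGroup Y] [NormedSpace 𝕜 Y]

variable {𝕜 X Y} in
/-- The linear functional on the algebraic tensor product `X ⊗ Y` induced by a continuous bilinear
functional `S` on `X × Y`, with `x ⊗ y ↦ S x y`. -/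
def bilinearToTensor (S : X →L[𝕜] Y →L[𝕜] 𝕜) : X ⊗[𝕜] Y →ₗ[𝕜] 𝕜 :=
  TensorProduct.lift (LinearMap.mk₂ 𝕜 (fun x y => S x y) (by simp) (by simp) (by simp) (by simp))

/-- The algebraic tensor product `X ⊗ Y`, to be equipped with the projective norm. (A copy, because
Mathlib puts another norm on `X ⊗[𝕜] Y` when `X` and `Y` are inner product spaces.) -/
def AlgebraicTensor : Type _ := X ⊗[𝕜] Y

instance : AddCommGroup (AlgebraicTensor 𝕜 X Y) := inferInstanceAs (AddCommGroup (X ⊗[𝕜] Y))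

instance : Module 𝕜 (AlgebraicTensor 𝕜 X Y) := inferInstanceAs (Module 𝕜 (X ⊗[𝕜] Y))

variable {𝕜 X Y} in
theorem bddAbove_projectiveNorm (z : X ⊗[𝕜] Y) :
    BddAbove (Set.range fun S : {S : X →L[𝕜] Y →L[𝕜] 𝕜 // ‖S‖ ≤ 1} =>
      ‖bilinearToTensor S.1 z‖) := by
  induction z using TensorProduct.induction_on with
  | zero => exact ⟨0, by rintro _ ⟨S, rfl⟩; simp⟩
  | tmul x y =>
    refine ⟨‖x‖ * ‖y‖, ?_⟩
    rintro _ ⟨S, rfl⟩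
    have h1 : ‖S.1 x y‖ ≤ ‖S.1‖ * ‖x‖ * ‖y‖ := S.1.le_opNorm₂ x y
    have h2 : ‖S.1‖ * ‖x‖ * ‖y‖ ≤ 1 * ‖x‖ * ‖y‖ := by
      have := S.2
      gcongr
    simpa [bilinearToTensor] using h1.trans h2
  | add z w hz hw =>
    obtain ⟨a, ha⟩ := hz
    obtain ⟨b, hb⟩ := hw
    refine ⟨a + b, ?_⟩
    rintro _ ⟨S, rfl⟩
    simp only [map_add]
    exact (norm_add_le _ _).trans (add_le_add (ha ⟨S, rfl⟩) (hb ⟨S, rfl⟩))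

/-- The projective norm
`‖z‖ = sup {|S z| : S a continuous bilinear functional on X × Y with ‖S‖ ≤ 1}`. -/
def projectiveNorm : Seminorm 𝕜 (AlgebraicTensor 𝕜 X Y) :=
  Seminorm.of
    (fun z => ⨆ S : {S : X →L[𝕜] Y →L[𝕜] 𝕜 // ‖S‖ ≤ 1}, ‖bilinearToTensor S.1 z‖)
    (fun z w => by
      have : Nonempty {S : X →L[𝕜] Y →L[𝕜] 𝕜 // ‖S‖ ≤ 1} :=
        ⟨⟨0, ContinuousLinearMap.opNorm_zero.trans_le zero_le_one⟩⟩
      refine ciSup_le fun S => ?_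
      have h : bilinearToTensor S.1 (z + w) = bilinearToTensor S.1 z + bilinearToTensor S.1 w :=
        (bilinearToTensor S.1).map_add z w
      exact h ▸ (norm_add_le _ _).trans (add_le_add (le_ciSup (bddAbove_projectiveNorm z) S)
        (le_ciSup (bddAbove_projectiveNorm w) S)))
    (fun a z => by
      rw [Real.mul_iSup_of_nonneg (norm_nonneg a)]
      refine iSup_congr fun S => ?_
      have h : bilinearToTensor S.1 (a • z) = a • bilinearToTensor S.1 z :=
        (bilinearToTensor S.1).map_smul a z
      exact h ▸ norm_smul a (bilinearToTensor S.1 z))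

instance : SeminormedAddCommGroup (AlgebraicTensor 𝕜 X Y) :=
  AddGroupSeminorm.toSeminormedAddCommGroup (projectiveNorm 𝕜 X Y).toAddGroupSeminorm

instance : NormedSpace 𝕜 (AlgebraicTensor 𝕜 X Y) where
  norm_smul_le a z := ((projectiveNorm 𝕜 X Y).smul' a z).le

/-- The projective tensor product of `X` and `Y`: the completion of the algebraic tensor product
with respect to the projective norm. -/
abbrev ProjectiveTensorProduct : Type _ := UniformSpace.Completion (AlgebraicTensor 𝕜 X Y)

end ProjectiveTensorProduct

end

/-! For finite index sets `C`, `D`, the identity of the projective tensor product is `P_C ⊗ id + (id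
- P_C) ⊗ Q_D` plus the tail `(id - P_C) ⊗ (id - Q_D)`. Each of the first two summands has a
finite-rank factor, so it is a finite sum of operators factoring through `Y` or through `X`; hence
one weakly compact set strongly generates its images of weakly compact sets. There are countably
many pairs `(C, D)`, and the corresponding generating sets, suitably shrunk, glue to a single one
(`isSWCG_of_forall_exists_isSWCGOperator`).

It remains to make the tail uniformly small on a given weakly compact `K`
(`IsWeaklyCompact.exists_norm_map_sub_projFinset_le`). Otherwise there are pairwise disjoint `A_k`,
pairwise disjoint `B_k` and `z_k ∈ K` with `‖(P_{A_k} ⊗ Q_{B_k}) z_k‖ > ε`. The lower estimates,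
Hölder's inequality and `1/p + 1/q ≥ 1` bound `∑ ‖P_{A_k} x‖ ‖Q_{B_k} y‖` by a multiple of `‖x‖
‖y‖`. Composing the blocks with functionals norming them at `z_k` thus gives a bounded operator into
`ℓ¹` whose `k`-th coordinate at `z_k` exceeds `ε`, against the Schur property
(`IsWeaklyCompact.exists_norm_apply_lt`). -/

noncomputable section

open Filter Topology

/-- An ultrafilter on the union either contains some `S i`, and converges there, or avoids every
finite union of the `S i`, and then converges to `x`. -/
theorem isCompact_insert_iUnion {T ι : Type*} [TopologicalSpace T] {S : ι → Set T} {x : T}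
    (hS : ∀ i, IsCompact (S i)) (h : ∀ V ∈ 𝓝 x, {i | ¬ S i ⊆ V}.Finite) :
    IsCompact (insert x (⋃ i, S i)) := by
  rw [isCompact_iff_ultrafilter_le_nhds]
  intro u hu
  rw [le_principal_iff] at hu
  by_cases hi : ∃ i, S i ∈ u
  · obtain ⟨i, hi⟩ := hi
    obtain ⟨y, hy, hle⟩ := (isCompact_iff_ultrafilter_le_nhds.1 (hS i)) u (le_principal_iff.2 hi)
    exact ⟨y, Or.inr (Set.mem_iUnion.2 ⟨i, hy⟩), hle⟩
  · refine ⟨x, Or.inl rfl, fun V hV => ?_⟩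
    have h1 : (⋃ i ∈ {i | ¬ S i ⊆ V}, S i) ∉ u := by
      rw [Ultrafilter.finite_biUnion_mem_iff (h V hV)]
      rintro ⟨i, -, hi'⟩
      exact hi ⟨i, hi'⟩
    have h2 := Ultrafilter.compl_mem_iff_notMem.2 h1
    filter_upwards [hu, h2] with y hy hy2
    rcases hy with rfl | hy
    · exact mem_of_mem_nhds hV
    · obtain ⟨i, hi⟩ := Set.mem_iUnion.1 hy
      by_contra hyV
      exact hy2 (Set.mem_biUnion (show i ∈ {i | ¬ S i ⊆ V} from fun hs => hyV (hs hi)) hi)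

/-! ### Weakly compact sets and operators with strongly generated images -/

section WeaklyCompact

variable {𝕜 : Type*} [RCLike 𝕜] {E : Type*} [NormedAddCommGroup E] [NormedSpace 𝕜 E]
  {F : Type*} [NormedAddCommGroup F] [NormedSpace 𝕜 F]
  {H : Type*} [NormedAddCommGroup H] [NormedSpace 𝕜 H]

namespace IsWeaklyCompact

theorem image {K : Set E} (hK : IsWeaklyCompact 𝕜 K) (f : E →L[𝕜] F) :
    IsWeaklyCompact 𝕜 (f '' K) := by
  have h := IsCompact.image (f := WeakSpace.map f) hK (WeakSpace.map f).continuous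
  rw [Set.image_image] at h
  rw [IsWeaklyCompact, Set.image_image]
  exact h

theorem add {K L : Set E} (hK : IsWeaklyCompact 𝕜 K) (hL : IsWeaklyCompact 𝕜 L) :
    IsWeaklyCompact 𝕜 (K + L) := by
  have h := IsCompact.add hK hL
  rwa [IsWeaklyCompact, Set.image_add]

theorem zero : IsWeaklyCompact 𝕜 ({0} : Set E) := by
  simp [IsWeaklyCompact]

theorem smul {K : Set E} (hK : IsWeaklyCompact 𝕜 K) (a : 𝕜) : IsWeaklyCompact 𝕜 (a • K) := by
  have h := hK.image (a • ContinuousLinearMap.id 𝕜 E)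
  exact h

/-- Every functional is bounded on `K`, so the uniform boundedness principle applies to `K` viewed
in the bidual. -/
theorem exists_bound {K : Set E} (hK : IsWeaklyCompact 𝕜 K) : ∃ M : ℝ, ∀ x ∈ K, ‖x‖ ≤ M := by
  have key : ∀ f : StrongDual 𝕜 E, ∃ C, ∀ x : K,
      ‖NormedSpace.inclusionInDoubleDual 𝕜 E x f‖ ≤ C := by
    intro f
    have h : IsWeaklyCompact 𝕜 (f '' K) := hK.image f
    have hc : IsCompact (f '' K) := by
      have := IsCompact.image (f := fun x : WeakSpace 𝕜 E => f ((toWeakSpace 𝕜 E).symm x)) hK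
        (WeakBilin.eval_continuous (topDualPairing 𝕜 E).flip f)
      rw [Set.image_image] at this
      simpa using this
    obtain ⟨C, hC⟩ := hc.isBounded.exists_norm_le
    exact ⟨C, fun x => hC _ ⟨x, x.2, rfl⟩⟩
  obtain ⟨C, hC⟩ := banach_steinhaus key
  refine ⟨C, fun x hx => ?_⟩
  have := hC ⟨x, hx⟩
  rwa [show ‖NormedSpace.inclusionInDoubleDual 𝕜 E x‖ = ‖x‖ from
    (NormedSpace.inclusionInDoubleDualLi 𝕜).norm_map x] at this

/-- Multiplying by the compact unit ball of scalars preserves weak compactness. Balancedness makes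
`n G` increase with `n`, so that different multiples can be replaced by their maximum. -/
theorem exists_balanced {K : Set E} (hK : IsWeaklyCompact 𝕜 K) :
    ∃ L : Set E, K ⊆ L ∧ IsWeaklyCompact 𝕜 L ∧ Balanced 𝕜 L := by
  refine ⟨Metric.closedBall (0 : 𝕜) 1 • K, fun x hx => ⟨1, by simp, x, hx, one_smul _ _⟩, ?_, ?_⟩
  · have h := IsCompact.smul_set (isCompact_closedBall (0 : 𝕜) 1) hK
    rw [IsWeaklyCompact, ← Set.image2_smul, Set.image_image2]
    rwa [← Set.image2_smul, Set.image2_image_right] at h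
  · rintro a ha _ ⟨_, ⟨b, hb, x, hx, rfl⟩, rfl⟩
    refine ⟨a * b, ?_, x, hx, mul_smul _ _ _⟩
    rw [mem_closedBall_zero_iff] at hb ⊢
    rw [norm_mul]
    exact mul_le_one₀ ha (norm_nonneg _) hb

end IsWeaklyCompact

variable (𝕜) in
/-- The images under `T` of the weakly compact sets are strongly generated by one balanced weakly
compact set, in the sense of `IsSWCG`. -/
def IsSWCGOperator (T : E →L[𝕜] F) : Prop :=
  ∃ G : Set F, IsWeaklyCompact 𝕜 G ∧ Balanced 𝕜 G ∧ ∀ K : Set E, IsWeaklyCompact 𝕜 K →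
    ∀ ε : ℝ, 0 < ε → ∃ n : ℕ, T '' K ⊆ (n : 𝕜) • G + Metric.closedBall (0 : F) ε

/-- An operator factoring through an SWCG space inherits a generating set: the image under `A` of a
balanced generator of `F`. -/
theorem IsSWCG.isSWCGOperator_comp (hF : IsSWCG 𝕜 F) (A : F →L[𝕜] H) (B : E →L[𝕜] F) :
    IsSWCGOperator 𝕜 (A ∘L B) := by
  obtain ⟨G, hG, h⟩ := hF
  obtain ⟨G', hGG', hG', hb⟩ := hG.exists_balanced
  refine ⟨A '' G', hG'.image A, ?_, fun K hK ε hε => ?_⟩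
  · rintro a ha _ ⟨_, ⟨x, hx, rfl⟩, rfl⟩
    exact ⟨a • x, hb a ha ⟨x, hx, rfl⟩, map_smul _ _ _⟩
  · obtain ⟨n, hn⟩ := h _ (hK.image B) (ε / (‖A‖ + 1)) (by positivity)
    refine ⟨n, ?_⟩
    rintro _ ⟨x, hx, rfl⟩
    obtain ⟨_, ⟨g, hg, rfl⟩, w, hw, hgw⟩ := hn ⟨x, hx, rfl⟩
    refine ⟨(n : 𝕜) • A g, ⟨A g, ⟨g, hGG' hg, rfl⟩, rfl⟩, A w, ?_, ?_⟩
    · rw [mem_closedBall_zero_iff] at hw ⊢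
      rw [le_div_iff₀ (by positivity)] at hw
      nlinarith [A.le_opNorm w, norm_nonneg w]
    · simp [← hgw]

namespace IsSWCGOperator

theorem zero : IsSWCGOperator 𝕜 (0 : E →L[𝕜] F) :=
  ⟨{0}, IsWeaklyCompact.zero, by rintro a - _ ⟨x, rfl, rfl⟩; simp, fun K _ ε hε => ⟨0, by
    rintro _ ⟨x, -, rfl⟩
    exact ⟨0, ⟨0, rfl, by simp⟩, 0, by simp [hε.le], by simp⟩⟩⟩

theorem _root_.Balanced.natCast_smul_mono {G : Set F} (hG : Balanced 𝕜 G) {m n : ℕ} (h : m ≤ n) :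
    (m : 𝕜) • G ⊆ (n : 𝕜) • G :=
  hG.smul_mono (by simpa using h)

theorem add {S T : E →L[𝕜] F} (hS : IsSWCGOperator 𝕜 S) (hT : IsSWCGOperator 𝕜 T) :
    IsSWCGOperator 𝕜 (S + T) := by
  obtain ⟨G, hG, hGb, h⟩ := hS
  obtain ⟨G', hG', hGb', h'⟩ := hT
  refine ⟨G + G', hG.add hG', hGb.add hGb', fun K hK ε hε => ?_⟩
  obtain ⟨m, hm⟩ := h K hK (ε / 2) (by positivity)
  obtain ⟨n, hn⟩ := h' K hK (ε / 2) (by positivity)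
  refine ⟨max m n, ?_⟩
  rintro _ ⟨x, hx, rfl⟩
  obtain ⟨g, hg, w, hw, hgw⟩ := hm ⟨x, hx, rfl⟩
  obtain ⟨g', hg', w', hw', hgw'⟩ := hn ⟨x, hx, rfl⟩
  refine ⟨g + g', ?_, w + w', ?_, ?_⟩
  · rw [smul_add]
    exact Set.add_mem_add (hGb.natCast_smul_mono (le_max_left _ _) hg)
      (hGb'.natCast_smul_mono (le_max_right _ _) hg')
  · rw [mem_closedBall_zero_iff] at hw hw' ⊢
    linarith [norm_add_le w w']
  · simp only [add_apply, ← hgw, ← hgw']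
    exact add_add_add_comm _ _ _ _

theorem sum {ι : Type*} (s : Finset ι) {T : ι → E →L[𝕜] F}
    (h : ∀ i ∈ s, IsSWCGOperator 𝕜 (T i)) : IsSWCGOperator 𝕜 (∑ i ∈ s, T i) :=
  Finset.sum_induction _ _ (fun _ _ => add) zero h

end IsSWCGOperator

/-- Shrinking the generators `G i` to norms tending to `0` makes their union with `{0}` weakly
compact; the shrinking factor is absorbed in the multiple `n`. -/
theorem isSWCG_of_forall_exists_isSWCGOperator {ι : Type*} [Countable ι] (T : ι → E →L[𝕜] E)
    (hT : ∀ i, IsSWCGOperator 𝕜 (T i))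
    (happrox : ∀ K : Set E, IsWeaklyCompact 𝕜 K → ∀ ε : ℝ, 0 < ε →
      ∃ i, ∀ z ∈ K, ‖z - T i z‖ ≤ ε) : IsSWCG 𝕜 E := by
  choose G hG hGb h using hT
  obtain ⟨e, he⟩ := exists_injective_nat ι
  have hM : ∀ i, ∃ M : ℕ, 0 < M ∧ ∀ x ∈ G i, ‖x‖ ≤ M := fun i => by
    obtain ⟨M, hM⟩ := (hG i).exists_bound
    obtain ⟨k, hk⟩ := exists_nat_ge M
    exact ⟨k + 1, k.succ_pos, fun x hx => (hM x hx).trans (hk.trans (by simp))⟩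
  choose M hM0 hM using hM
  -- Dividing by `c i` puts `G i` into the ball of radius `1 / (e i + 1)`.
  let c : ι → ℕ := fun i => (e i + 1) * M i
  have hc : ∀ i, (c i : 𝕜) ≠ 0 := fun i =>
    Nat.cast_ne_zero.2 (Nat.mul_pos (Nat.succ_pos _) (hM0 i)).ne'
  refine ⟨insert 0 (⋃ i, (c i : 𝕜)⁻¹ • G i), ?_, fun K hK ε hε => ?_⟩
  · rw [IsWeaklyCompact, Set.image_insert_eq, Set.image_iUnion]
    refine isCompact_insert_iUnion (fun i => (hG i).smul _) fun V hV => ?_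
    -- A weak neighbourhood of `0` contains a norm ball, hence all but finitely many of the shrunk
    -- sets.
    have hV' : toWeakSpaceCLM 𝕜 E ⁻¹' V ∈ 𝓝 (0 : E) :=
      (toWeakSpaceCLM 𝕜 E).continuous.continuousAt.preimage_mem_nhds (by simpa using hV)
    obtain ⟨r, hr, hrV⟩ := Metric.mem_nhds_iff.1 hV'
    obtain ⟨k, hk⟩ := exists_nat_one_div_lt hr
    refine ((Set.finite_lt_nat k).preimage he.injOn).subset fun i hi => ?_
    by_contra hik
    apply hi
    rintro _ ⟨_, ⟨x, hx, rfl⟩, rfl⟩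
    refine hrV (a := (c i : 𝕜)⁻¹ • x) ?_
    have hik' : (k : ℝ) ≤ e i := by simpa using hik
    have hMi : (0 : ℝ) < M i := Nat.cast_pos.2 (hM0 i)
    rw [mem_ball_zero_iff]
    refine lt_of_le_of_lt ?_ hk
    simp only [c, norm_smul, norm_inv, RCLike.norm_natCast]
    push_cast
    calc ((e i + 1 : ℝ) * M i)⁻¹ * ‖x‖ ≤ ((e i + 1 : ℝ) * M i)⁻¹ * M i := by
          gcongr; exact hM i x hx
      _ = 1 / (e i + 1) := by field_simp
      _ ≤ 1 / (k + 1) := by gcongr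
  · obtain ⟨i, hi⟩ := happrox K hK (ε / 2) (by positivity)
    obtain ⟨n, hn⟩ := h i K hK (ε / 2) (by positivity)
    refine ⟨n * c i, fun z hz => ?_⟩
    obtain ⟨_, ⟨g, hg, rfl⟩, w, hw, hgw⟩ := hn ⟨z, hz, rfl⟩
    refine ⟨((n * c i : ℕ) : 𝕜) • (c i : 𝕜)⁻¹ • g,
      ⟨_, Or.inr (Set.mem_iUnion.2 ⟨i, ⟨g, hg, rfl⟩⟩), rfl⟩, w + (z - T i z), ?_, ?_⟩
    · rw [mem_closedBall_zero_iff] at hw ⊢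
      linarith [norm_add_le w (z - T i z), hi z hz]
    · have : ((n * c i : ℕ) : 𝕜) • (c i : 𝕜)⁻¹ • g = (n : 𝕜) • g := by
        rw [smul_smul, Nat.cast_mul, mul_assoc, mul_inv_cancel₀ (hc i), mul_one]
      simp only [this]
      rw [← add_assoc]
      simp only at hgw
      rw [hgw, add_sub_cancel]

end WeaklyCompact

/-! ### The Schur property of `ℓ¹` by a gliding hump -/

section Schur

variable {𝕜 : Type*} [RCLike 𝕜] {E : Type*} [NormedAddCommGroup E] [NormedSpace 𝕜 E]

/-- A weak cluster point, tested on finitely many functionals at a time; no weakly convergent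
subsequence is needed. -/
theorem IsWeaklyCompact.exists_frequently_norm_sub_lt {K : Set E} (hK : IsWeaklyCompact 𝕜 K)
    {z : ℕ → E} (hz : ∀ k, z k ∈ K) :
    ∃ x : E, ∀ (s : Finset (StrongDual 𝕜 E)) (δ : ℝ), 0 < δ →
      ∃ᶠ k in atTop, ∀ f ∈ s, ‖f (z k - x)‖ < δ := by
  obtain ⟨x, -, hx⟩ := hK.exists_mapClusterPt_of_frequently (l := atTop)
    (f := fun k => toWeakSpace 𝕜 E (z k))
    (Frequently.of_forall fun k => Set.mem_image_of_mem _ (hz k))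
  refine ⟨(toWeakSpace 𝕜 E).symm x, fun s δ hδ => ?_⟩
  have hV : ∀ᶠ y in 𝓝 x, ∀ f ∈ s,
      ‖f ((toWeakSpace 𝕜 E).symm y - (toWeakSpace 𝕜 E).symm x)‖ < δ := by
    rw [Finset.eventually_all]
    intro f _
    have hf : Continuous fun y : WeakSpace 𝕜 E => f ((toWeakSpace 𝕜 E).symm y) :=
      WeakBilin.eval_continuous (topDualPairing 𝕜 E).flip f
    have hc : Continuous fun y : WeakSpace 𝕜 E =>
        ‖f ((toWeakSpace 𝕜 E).symm y) - f ((toWeakSpace 𝕜 E).symm x)‖ :=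
      (hf.sub continuous_const).norm
    have := (hc.tendsto x).eventually_lt_const (u := δ) (by simpa using hδ)
    simpa only [map_sub] using this
  simpa using hx.frequently hV

/-- An operator into `ℓ¹`, given by its coordinate functionals `ψ k`, maps weakly compact sets to
sets with uniformly small coordinates (a form of the Schur property). -/
theorem IsWeaklyCompact.exists_norm_apply_lt {K : Set E} (hK : IsWeaklyCompact 𝕜 K)
    {ψ : ℕ → StrongDual 𝕜 E} {C : ℝ} (hψ : ∀ (x : E) (s : Finset ℕ), ∑ k ∈ s, ‖ψ k x‖ ≤ C * ‖x‖)
    {z : ℕ → E} (hz : ∀ k, z k ∈ K) {ε : ℝ} (hε : 0 < ε) : ∃ k, ‖ψ k (z k)‖ < ε := by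
  by_contra! hcon
  have hsum : ∀ x, Summable fun k => ‖ψ k x‖ := fun x =>
    summable_of_sum_le (fun _ => norm_nonneg _) (hψ x)
  have hlim : ∀ x, Tendsto (fun k => ‖ψ k x‖) atTop (𝓝 0) := fun x => (hsum x).tendsto_atTop_zero
  obtain ⟨x, hx⟩ := hK.exists_frequently_norm_sub_lt hz
  have hδ : 0 < ε / 12 := by positivity
  set δ := ε / 12 with hδε
  -- Pairs `(k, m)`: `k` is the chosen index, and `m` is a strictly increasing label that makes the
  -- off-diagonal bounds summable. Earlier functionals are small at the new vector by the choice of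
  -- the cluster point `x`, the new functional at earlier vectors because coordinates tend to `0`.
  obtain ⟨f, hf, hfr⟩ := exists_seq_of_forall_finset_exists
    (fun a : ℕ × ℕ => ε / 2 ≤ ‖ψ a.1 (z a.1 - x)‖)
    (fun a b => (a.1 < b.1 ∧ a.2 < b.2) ∧ ‖ψ a.1 (z b.1 - x)‖ ≤ δ * (1 / 2) ^ a.2 ∧
      ‖ψ b.1 (z a.1 - x)‖ ≤ δ * (1 / 2) ^ b.2) (by
    intro s _
    obtain ⟨m, hm⟩ : ∃ m, ∀ a ∈ s, a.2 < m :=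
      ⟨s.sup Prod.snd + 1, fun a ha => Nat.lt_succ_of_le (Finset.le_sup (f := Prod.snd) ha)⟩
    have h1 : ∀ᶠ k in atTop, ∀ a ∈ s, ‖ψ k (z a.1 - x)‖ ≤ δ * (1 / 2) ^ m := by
      rw [Finset.eventually_all]
      intro a _
      exact (hlim _).eventually_le_const (by positivity)
    have h2 : ∀ᶠ k in atTop, ∀ a ∈ s, a.1 < k := by
      rw [Finset.eventually_all]
      intro a _
      exact eventually_gt_atTop _
    have h3 : ∀ᶠ k in atTop, ‖ψ k x‖ ≤ ε / 2 := (hlim x).eventually_le_const (by positivity)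
    classical
    obtain ⟨k, hk, hk1, hk2, hk3⟩ := ((hx (s.image fun a => ψ a.1) (δ * (1 / 2) ^ m)
      (by positivity)).and_eventually (h1.and (h2.and h3))).exists
    refine ⟨(k, m), ?_, fun a ha => ⟨⟨hk2 a ha, hm a ha⟩, ?_, hk1 a ha⟩⟩
    · have := norm_sub_norm_le (ψ k (z k)) (ψ k x)
      simp only [map_sub]
      linarith [hcon k]
    · refine (hk _ (Finset.mem_image_of_mem _ ha)).le.trans ?_
      exact mul_le_mul_of_nonneg_left
        (pow_le_pow_of_le_one (by norm_num) (by norm_num) (hm a ha).le) hδ.le)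
  have hm1 : StrictMono fun i => (f i).1 := fun i j h => (hfr i j h).1.1
  have hm2 : StrictMono fun i => (f i).2 := fun i j h => (hfr i j h).1.2
  have hpow : ∀ i, δ * (1 / 2 : ℝ) ^ (f i).2 ≤ δ * (1 / 2) ^ i := fun i =>
    mul_le_mul_of_nonneg_left
      (pow_le_pow_of_le_one (by norm_num) (by norm_num) (hm2.id_le i)) hδ.le
  have hoff : ∀ i j, i ≠ j → ‖ψ (f i).1 (z (f j).1 - x)‖ ≤ δ * (1 / 2) ^ i := fun i j hij => by
    rcases hij.lt_or_gt with h | h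
    · exact (hfr i j h).2.1.trans (hpow i)
    · exact (hfr j i h).2.2.trans (hpow i)
  have hgeom : HasSum (fun i : ℕ => δ * (1 / 2 : ℝ) ^ i) (δ * 2) := hasSum_geometric_two.mul_left δ
  have hsub : ∀ y, Summable fun i => ψ (f i).1 y := fun y =>
    Summable.of_norm ((hsum y).comp_injective hm1.injective)
  -- At `z (f j).1 - x` the sum of the chosen functionals is dominated by its `j`-th term.
  obtain ⟨Ψ, hΨ⟩ : ∃ Ψ : StrongDual 𝕜 E, ∀ y, HasSum (fun i => ψ (f i).1 y) (Ψ y) := by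
    let L : E →ₗ[𝕜] 𝕜 :=
      { toFun := fun y => ∑' i, ψ (f i).1 y
        map_add' := fun y y' => by
          simp only [map_add]
          exact (hsub y).tsum_add (hsub y')
        map_smul' := fun a y => by
          simp only [map_smul, smul_eq_mul, RingHom.id_apply]
          exact tsum_mul_left }
    refine ⟨L.mkContinuous C fun y => ?_, fun y => (hsub y).hasSum⟩
    refine le_of_tendsto (hsub y).hasSum.norm (Eventually.of_forall fun s => ?_)
    refine (norm_sum_le _ _).trans ?_
    have := hψ y (s.map ⟨_, hm1.injective⟩)
    rwa [Finset.sum_map] at this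
  have hdiag : ∀ j, ε / 2 ≤ ‖Ψ (z (f j).1 - x)‖ + δ * 2 := fun j => by
    have h1 := hasSum_ite_sub_hasSum (hΨ (z (f j).1 - x)) j
    have h2 : ‖Ψ (z (f j).1 - x) - ψ (f j).1 (z (f j).1 - x)‖ ≤ δ * 2 := by
      rw [← h1.tsum_eq]
      refine tsum_of_norm_bounded hgeom fun i => ?_
      split_ifs with h
      · simpa using by positivity
      · exact hoff i j h
    have h3 := norm_sub_norm_le (ψ (f j).1 (z (f j).1 - x)) (Ψ (z (f j).1 - x))
    rw [norm_sub_rev] at h3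
    linarith [hf j]
  -- `x` need not be a cluster point of the subsequence, so a new one is taken; the off-diagonal
  -- bounds keep `Ψ (x' - x)` small.
  obtain ⟨x', hx'⟩ := hK.exists_frequently_norm_sub_lt (z := fun j => z (f j).1) fun j => hz _
  have hψx' : ∀ i, ‖ψ (f i).1 (x' - x)‖ ≤ δ * (1 / 2) ^ i := fun i => by
    refine le_of_forall_pos_le_add fun η hη => ?_
    obtain ⟨j, hj, hij⟩ := ((hx' {ψ (f i).1} η hη).and_eventually (eventually_gt_atTop i)).exists
    have h1 := hj _ (Finset.mem_singleton_self _)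
    have h2 := norm_sub_le (ψ (f i).1 (z (f j).1 - x)) (ψ (f i).1 (z (f j).1 - x'))
    rw [← map_sub, sub_sub_sub_cancel_left] at h2
    linarith [hoff i j hij.ne]
  have hΨx' : ‖Ψ (x' - x)‖ ≤ δ * 2 := by
    rw [← (hΨ _).tsum_eq]
    exact tsum_of_norm_bounded hgeom hψx'
  obtain ⟨j, hj⟩ := (hx' {Ψ} δ hδ).exists
  have h1 := hj _ (Finset.mem_singleton_self _)
  have h2 := norm_add_le (Ψ (z (f j).1 - x')) (Ψ (x' - x))
  rw [← map_add, sub_add_sub_cancel] at h2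
  -- Altogether `ε / 2 < δ + 2 * δ + 2 * δ`, which `δ = ε / 12` excludes.
  linarith [hdiag j]

end Schur

/-! ### Operators on the projective tensor product -/

section Tensor

variable {𝕜 : Type*} [RCLike 𝕜]
  {X : Type*} [NormedAddCommGroup X] [NormedSpace 𝕜 X]
  {Y : Type*} [NormedAddCommGroup Y] [NormedSpace 𝕜 Y]
  {F : Type*} [NormedAddCommGroup F] [NormedSpace 𝕜 F]

namespace AlgebraicTensor

variable (𝕜 X Y) in
/-- The bilinear map `(x, y) ↦ x ⊗ y` into the algebraic tensor product. -/
def mk : X →ₗ[𝕜] Y →ₗ[𝕜] AlgebraicTensor 𝕜 X Y := TensorProduct.mk 𝕜 X Y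

/-- The linear functional on the algebraic tensor product induced by a bounded bilinear form. -/
def eval (S : X →L[𝕜] Y →L[𝕜] 𝕜) : AlgebraicTensor 𝕜 X Y →ₗ[𝕜] 𝕜 := bilinearToTensor S

theorem eval_mk (S : X →L[𝕜] Y →L[𝕜] 𝕜) (x : X) (y : Y) : eval S (mk 𝕜 X Y x y) = S x y :=
  TensorProduct.lift.tmul _ _

theorem norm_eval_le {S : X →L[𝕜] Y →L[𝕜] 𝕜} (hS : ‖S‖ ≤ 1)
    (z : AlgebraicTensor 𝕜 X Y) : ‖eval S z‖ ≤ ‖z‖ :=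
  le_ciSup (bddAbove_projectiveNorm z) (⟨S, hS⟩ : {S : X →L[𝕜] Y →L[𝕜] 𝕜 // ‖S‖ ≤ 1})

theorem norm_mk_le (x : X) (y : Y) : ‖mk 𝕜 X Y x y‖ ≤ ‖x‖ * ‖y‖ := by
  have : Nonempty {S : X →L[𝕜] Y →L[𝕜] 𝕜 // ‖S‖ ≤ 1} :=
    ⟨⟨0, ContinuousLinearMap.opNorm_zero.trans_le zero_le_one⟩⟩
  refine ciSup_le fun S => ?_
  have h1 : ‖S.1 x y‖ ≤ ‖S.1‖ * ‖x‖ * ‖y‖ := S.1.le_opNorm₂ x y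
  have h2 : ‖S.1‖ * ‖x‖ * ‖y‖ ≤ 1 * ‖x‖ * ‖y‖ := by
    have := S.2
    gcongr
  rw [one_mul] at h2
  exact (congrArg norm (eval_mk S.1 x y)).trans_le (h1.trans h2)

theorem induction_on {p : AlgebraicTensor 𝕜 X Y → Prop} (z : AlgebraicTensor 𝕜 X Y) (h0 : p 0)
    (hmk : ∀ x y, p (mk 𝕜 X Y x y)) (hadd : ∀ z w, p z → p w → p (z + w)) : p z :=
  TensorProduct.induction_on (motive := p) z h0 hmk hadd

theorem linearMap_ext {L L' : AlgebraicTensor 𝕜 X Y →ₗ[𝕜] F}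
    (h : ∀ x y, L (mk 𝕜 X Y x y) = L' (mk 𝕜 X Y x y)) : L = L' :=
  TensorProduct.ext' (R := 𝕜) (M := X) (N := Y) (g := L) (h := L') h

/-- Composed with a functional norming `L z` and divided by `M`, the map `L` becomes a bilinear form
competing in the supremum that defines `‖z‖`. The case `M = 0` is separate because of the division.
-/
theorem norm_apply_le (L : AlgebraicTensor 𝕜 X Y →ₗ[𝕜] F) {M : ℝ} (hM : 0 ≤ M)
    (hL : ∀ x y, ‖L (mk 𝕜 X Y x y)‖ ≤ M * ‖x‖ * ‖y‖) (z : AlgebraicTensor 𝕜 X Y) :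
    ‖L z‖ ≤ M * ‖z‖ := by
  obtain ⟨g, hg, hgz⟩ := exists_dual_vector'' 𝕜 (L z)
  have hgL : ∀ x y, ‖g (L (mk 𝕜 X Y x y))‖ ≤ M * ‖x‖ * ‖y‖ := fun x y =>
    (g.le_of_opNorm_le hg _).trans (by simpa using hL x y)
  have hn : ‖g (L z)‖ = ‖L z‖ := by rw [hgz]; simp
  rw [← hn]
  rcases hM.eq_or_lt with rfl | hM
  · have h0 : g.toLinearMap ∘ₗ L = 0 := linearMap_ext fun x y => by simpa using hgL x y
    have : g (L z) = 0 := LinearMap.congr_fun h0 z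
    simp [this]
  · have hM' : ‖(M : 𝕜)⁻¹‖ = M⁻¹ := by rw [norm_inv, RCLike.norm_ofReal, abs_of_pos hM]
    let B : X →ₗ[𝕜] Y →ₗ[𝕜] 𝕜 := (mk 𝕜 X Y).compr₂ ((M : 𝕜)⁻¹ • (g.toLinearMap ∘ₗ L))
    have hB : ∀ x y, ‖B x y‖ ≤ 1 * ‖x‖ * ‖y‖ := fun x y => by
      have : B x y = (M : 𝕜)⁻¹ * g (L (mk 𝕜 X Y x y)) := rfl
      rw [this, norm_mul, hM', inv_mul_le_iff₀ hM, one_mul, ← mul_assoc]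
      exact hgL x y
    have hE : eval (B.mkContinuous₂ 1 hB) = (M : 𝕜)⁻¹ • (g.toLinearMap ∘ₗ L) :=
      linearMap_ext fun x y => eval_mk _ x y
    have h1 := norm_eval_le (B.mkContinuous₂_norm_le zero_le_one hB) z
    have h2 : eval (B.mkContinuous₂ 1 hB) z = (M : 𝕜)⁻¹ * g (L z) := LinearMap.congr_fun hE z
    rwa [h2, norm_mul, hM', inv_mul_le_iff₀ hM] at h1

end AlgebraicTensor

namespace ProjectiveTensorProduct

variable (𝕜 X Y) in
/-- The bilinear map `(x, y) ↦ x ⊗ y` into the projective tensor product. -/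
def mk : X →L[𝕜] Y →L[𝕜] ProjectiveTensorProduct 𝕜 X Y :=
  ((AlgebraicTensor.mk 𝕜 X Y).compr₂
    (UniformSpace.Completion.toComplₗᵢ (𝕜 := 𝕜) (E := AlgebraicTensor 𝕜 X Y)).toLinearMap
    ).mkContinuous₂ 1 fun x y => by
      rw [one_mul]
      exact (UniformSpace.Completion.norm_coe _).trans_le (AlgebraicTensor.norm_mk_le x y)

theorem mk_apply (x : X) (y : Y) : mk 𝕜 X Y x y =
    ((AlgebraicTensor.mk 𝕜 X Y x y : AlgebraicTensor 𝕜 X Y) : ProjectiveTensorProduct 𝕜 X Y) := rfl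

theorem norm_mk_le (x : X) (y : Y) : ‖mk 𝕜 X Y x y‖ ≤ ‖x‖ * ‖y‖ :=
  (UniformSpace.Completion.norm_coe _).trans_le (AlgebraicTensor.norm_mk_le x y)

theorem induction_on {p : ProjectiveTensorProduct 𝕜 X Y → Prop} (z : ProjectiveTensorProduct 𝕜 X Y)
    (hcl : IsClosed {z | p z}) (h0 : p 0) (hmk : ∀ x y, p (mk 𝕜 X Y x y))
    (hadd : ∀ z w, p z → p w → p (z + w)) : p z := by
  refine UniformSpace.Completion.induction_on z hcl fun a => ?_
  induction a using AlgebraicTensor.induction_on with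
  | h0 => exact h0
  | hmk x y => exact hmk x y
  | hadd z w hz hw => rw [UniformSpace.Completion.coe_add]; exact hadd _ _ hz hw

theorem ext {S T : ProjectiveTensorProduct 𝕜 X Y →L[𝕜] F}
    (h : ∀ x y, S (mk 𝕜 X Y x y) = T (mk 𝕜 X Y x y)) : S = T := by
  ext z
  induction z using ProjectiveTensorProduct.induction_on with
  | hcl => exact isClosed_eq S.continuous T.continuous
  | h0 => simp
  | hmk x y => exact h x y
  | hadd z w hz hw => rw [map_add, map_add, hz, hw]

theorem norm_apply_le (T : ProjectiveTensorProduct 𝕜 X Y →L[𝕜] F) {M : ℝ} (hM : 0 ≤ M)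
    (hT : ∀ x y, ‖T (mk 𝕜 X Y x y)‖ ≤ M * ‖x‖ * ‖y‖) (z : ProjectiveTensorProduct 𝕜 X Y) :
    ‖T z‖ ≤ M * ‖z‖ := by
  refine UniformSpace.Completion.induction_on z
    (isClosed_le T.continuous.norm (continuous_const.mul continuous_norm)) fun a => ?_
  rw [UniformSpace.Completion.norm_coe]
  exact AlgebraicTensor.norm_apply_le (T.toLinearMap ∘ₗ
    (UniformSpace.Completion.toComplₗᵢ (𝕜 := 𝕜) (E := AlgebraicTensor 𝕜 X Y)).toLinearMap) hM hT a

theorem exists_lift [CompleteSpace F] (Φ : X →L[𝕜] Y →L[𝕜] F) :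
    ∃ T : ProjectiveTensorProduct 𝕜 X Y →L[𝕜] F, ∀ x y, T (mk 𝕜 X Y x y) = Φ x y := by
  let L : AlgebraicTensor 𝕜 X Y →ₗ[𝕜] F :=
    TensorProduct.lift (LinearMap.mk₂ 𝕜 (fun x y => Φ x y) (by simp) (by simp) (by simp) (by simp))
  have hL : ∀ x y, L (AlgebraicTensor.mk 𝕜 X Y x y) = Φ x y := fun x y =>
    TensorProduct.lift.tmul _ _
  let L' : AlgebraicTensor 𝕜 X Y →L[𝕜] F := L.mkContinuous ‖Φ‖
    (AlgebraicTensor.norm_apply_le L Φ.opNorm_nonneg fun x y => by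
      rw [hL]; exact Φ.le_opNorm₂ x y)
  let e : AlgebraicTensor 𝕜 X Y →L[𝕜] ProjectiveTensorProduct 𝕜 X Y :=
    UniformSpace.Completion.toComplL
  refine ⟨L'.extend e, fun x y => ?_⟩
  rw [mk_apply]
  refine (L'.extend_eq (e := e) UniformSpace.Completion.denseRange_coe
    (UniformSpace.Completion.isUniformInducing_coe _) _).trans (hL x y)

/-- The operator on the projective tensor product induced by a bounded bilinear map. -/
def lift [CompleteSpace F] (Φ : X →L[𝕜] Y →L[𝕜] F) : ProjectiveTensorProduct 𝕜 X Y →L[𝕜] F :=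
  (exists_lift Φ).choose

@[simp]
theorem lift_mk [CompleteSpace F] (Φ : X →L[𝕜] Y →L[𝕜] F) (x : X) (y : Y) :
    lift Φ (mk 𝕜 X Y x y) = Φ x y :=
  (exists_lift Φ).choose_spec x y

/-- The tensor product `S ⊗ T` of two operators. -/
def map (S : X →L[𝕜] X) (T : Y →L[𝕜] Y) :
    ProjectiveTensorProduct 𝕜 X Y →L[𝕜] ProjectiveTensorProduct 𝕜 X Y :=
  lift ((mk 𝕜 X Y).bilinearComp S T)

@[simp]
theorem map_mk (S : X →L[𝕜] X) (T : Y →L[𝕜] Y) (x : X) (y : Y) :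
    map S T (mk 𝕜 X Y x y) = mk 𝕜 X Y (S x) (T y) := by
  simp [map]

theorem norm_map_apply_le {S : X →L[𝕜] X} {T : Y →L[𝕜] Y} {a b : ℝ} (ha : 0 ≤ a) (hb : 0 ≤ b)
    (hS : ∀ x, ‖S x‖ ≤ a * ‖x‖) (hT : ∀ y, ‖T y‖ ≤ b * ‖y‖) (z : ProjectiveTensorProduct 𝕜 X Y) :
    ‖map S T z‖ ≤ a * b * ‖z‖ := by
  refine norm_apply_le _ (mul_nonneg ha hb) (fun x y => ?_) z
  rw [map_mk]
  refine (norm_mk_le _ _).trans ?_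
  calc ‖S x‖ * ‖T y‖ ≤ (a * ‖x‖) * (b * ‖y‖) :=
        mul_le_mul (hS x) (hT y) (norm_nonneg _) (mul_nonneg ha (norm_nonneg _))
    _ = a * b * ‖x‖ * ‖y‖ := by ring

/-- The uniform bound gives equicontinuity, so the set of `z` with convergence is closed, and
elementary tensors suffice. -/
theorem tendsto_map {ι : Type*} {l : Filter ι} {S : ι → X →L[𝕜] X} {T : ι → Y →L[𝕜] Y} {a b : ℝ}
    (ha : 0 ≤ a) (hb : 0 ≤ b) (hS : ∀ i x, ‖S i x‖ ≤ a * ‖x‖) (hT : ∀ i y, ‖T i y‖ ≤ b * ‖y‖)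
    (hS' : ∀ x, Tendsto (fun i => S i x) l (𝓝 x)) (hT' : ∀ y, Tendsto (fun i => T i y) l (𝓝 y))
    (z : ProjectiveTensorProduct 𝕜 X Y) : Tendsto (fun i => map (S i) (T i) z) l (𝓝 z) := by
  induction z using ProjectiveTensorProduct.induction_on with
  | hcl =>
    have hE : Equicontinuous fun i => (map (S i) (T i) : ProjectiveTensorProduct 𝕜 X Y → _) := by
      refine LipschitzWith.uniformEquicontinuous _ ⟨a * b, mul_nonneg ha hb⟩ (fun i => ?_)
        |>.equicontinuous
      exact AddMonoidHomClass.lipschitz_of_bound_nnnorm _ _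
        fun z => norm_map_apply_le ha hb (hS i) (hT i) z
    exact hE.isClosed_setOfPred_tendsto continuous_id
  | h0 => simpa only [map_zero] using tendsto_const_nhds
  | hmk x y =>
    simp only [map_mk]
    have h : Continuous fun w : X × Y => mk 𝕜 X Y w.1 w.2 := (mk 𝕜 X Y).continuous₂
    have h' : Tendsto (fun w : X × Y => mk 𝕜 X Y w.1 w.2) (𝓝 (x, y)) (𝓝 (mk 𝕜 X Y x y)) :=
      h.tendsto (x, y)
    exact h'.comp (f := fun i => (S i x, T i y)) ((hS' x).prodMk_nhds (hT' y))
  | hadd z w hz hw => simpa only [map_add] using hz.add hw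

end ProjectiveTensorProduct
end Tensor

/-- The condition on the exponents says `q ≤ p'` for the conjugate `p'` of `p`. So the `ℓ^{p'}` norm
is at most the `ℓ^q` norm, and Hölder's inequality applies. -/
theorem sum_mul_le_of_sum_rpow_le {ι : Type*} {s : Finset ι} {f g : ι → ℝ} {p q A B : ℝ}
    (hp : 1 < p) (hq : 1 < q) (hpq : 1 ≤ 1 / p + 1 / q) (hf : ∀ i, 0 ≤ f i) (hg : ∀ i, 0 ≤ g i)
    (hA : 0 ≤ A) (hB : 0 ≤ B) (hfA : ∑ i ∈ s, f i ^ p ≤ A ^ p) (hgB : ∑ i ∈ s, g i ^ q ≤ B ^ q) :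
    ∑ i ∈ s, f i * g i ≤ A * B := by
  have hc := Real.HolderConjugate.conjExponent hp
  set p' := p.conjExponent
  have hp0 : 0 < p := by linarith
  have hp'0 : 0 < p' := hc.symm.pos
  have hqp' : q ≤ p' := by
    have h1 := hc.inv_add_inv_eq_one
    rw [one_div, one_div] at hpq
    exact (inv_le_inv₀ hp'0 (by linarith)).1 (by linarith)
  have hsplit : ∀ t : ℝ, 0 ≤ t → t ^ p' = t ^ (p' - q) * t ^ q := fun t ht => by
    rw [← Real.rpow_add' ht (by linarith), sub_add_cancel]
  have hgB' : ∀ i ∈ s, g i ≤ B := fun i hi => by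
    refine (Real.rpow_le_rpow_iff (hg i) hB (by linarith : 0 < q)).1 (le_trans ?_ hgB)
    exact Finset.single_le_sum (f := fun i => g i ^ q) (fun j _ => Real.rpow_nonneg (hg j) q) hi
  have hgp : ∑ i ∈ s, g i ^ p' ≤ B ^ p' := by
    calc ∑ i ∈ s, g i ^ p' ≤ ∑ i ∈ s, B ^ (p' - q) * g i ^ q := by
          refine Finset.sum_le_sum fun i hi => ?_
          rw [hsplit _ (hg i)]
          exact mul_le_mul_of_nonneg_right
            (Real.rpow_le_rpow (hg i) (hgB' i hi) (by linarith)) (Real.rpow_nonneg (hg i) q)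
      _ ≤ B ^ (p' - q) * B ^ q := by
          rw [← Finset.mul_sum]
          exact mul_le_mul_of_nonneg_left hgB (Real.rpow_nonneg hB _)
      _ = B ^ p' := (hsplit B hB).symm
  have hroot : ∀ {t S r : ℝ}, 0 < r → 0 ≤ t → 0 ≤ S → S ≤ t ^ r → S ^ (1 / r) ≤ t :=
    fun {t S r} hr ht hS h => by
      have := Real.rpow_le_rpow hS h (by positivity : 0 ≤ 1 / r)
      rwa [← Real.rpow_mul ht, mul_one_div_cancel hr.ne', Real.rpow_one] at this
  refine (Real.inner_le_Lp_mul_Lq_of_nonneg s hc (fun i _ => hf i) (fun i _ => hg i)).trans ?_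
  exact mul_le_mul (hroot hp0 hA (Finset.sum_nonneg fun i _ => Real.rpow_nonneg (hf i) p) hfA)
    (hroot hp'0 hB (Finset.sum_nonneg fun i _ => Real.rpow_nonneg (hg i) p') hgp)
    (Real.rpow_nonneg (Finset.sum_nonneg fun i _ => Real.rpow_nonneg (hg i) p') _) hA

/-! ### Finite projections of an unconditional decomposition -/

section Decomposition

variable {𝕜 : Type*} [RCLike 𝕜] {X : Type*} [NormedAddCommGroup X] [NormedSpace 𝕜 X]
  {I : Type*} {V : I → Submodule 𝕜 X}

namespace IsUnconditionalSchauderDecomposition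

variable (hV : IsUnconditionalSchauderDecomposition V)

theorem tendsto_projFinset (x : X) : Tendsto (fun C => hV.projFinset C x) atTop (𝓝 x) := by
  have h : HasSum (fun i => (hV.component x i : X)) x := hV.hasSum_component x
  simpa [HasSum, projFinset, proj] using h

theorem proj_of_mem [DecidableEq I] {j : I} {x : X} (hx : x ∈ V j) (i : I) :
    hV.proj i x = if i = j then x else 0 := by
  have h : HasSum (fun i => ((Pi.single j ⟨x, hx⟩ : ∀ i, V i) i : X)) x := by
    convert! hasSum_ite_eq j x using 2 with i
    by_cases hij : i = j
    · subst hij; simp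
    · simp [hij]
  have : hV.proj i x = ((Pi.single j ⟨x, hx⟩ : ∀ i, V i) i : X) :=
    congrArg Subtype.val (congrFun (hV.component_eq h) i)
  rw [this]
  by_cases hij : i = j
  · subst hij; simp
  · simp [hij]

theorem proj_mem (i : I) (x : X) : hV.proj i x ∈ V i := (hV.component x i).2

theorem projFinset_projFinset [DecidableEq I] (C D : Finset I) (x : X) :
    hV.projFinset C (hV.projFinset D x) = hV.projFinset (C ∩ D) x := by
  simp only [projFinset, LinearMap.sum_apply, map_sum]
  rw [Finset.sum_comm, ← Finset.filter_mem_eq_inter, Finset.sum_filter, Finset.sum_comm]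
  simp_rw [hV.proj_of_mem (hV.proj_mem _ x)]
  rw [Finset.sum_comm]
  simp

/-- Cutting a tail down to finitely many indices leaves a block disjoint from `D`. -/
theorem projFinset_sub_projFinset [DecidableEq I] (C D : Finset I) (x : X) :
    hV.projFinset C (x - hV.projFinset D x) = hV.projFinset (C \ D) x := by
  rw [map_sub, projFinset_projFinset, sub_eq_iff_eq_add']
  simp only [projFinset, LinearMap.sum_apply]
  exact (Finset.sum_inter_add_sum_sdiff _ _ _).symm

theorem finiteDimensional_range_projFinset (hfin : ∀ i, FiniteDimensional 𝕜 (V i))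
    (C : Finset I) : FiniteDimensional 𝕜 (LinearMap.range (hV.projFinset C)) := by
  have h : LinearMap.range (hV.projFinset C) ≤ C.sup V := by
    rintro _ ⟨x, rfl⟩
    rw [projFinset, LinearMap.sum_apply]
    exact Submodule.sum_mem _ fun i hi => Finset.le_sup (f := V) hi (hV.proj_mem i x)
  exact Submodule.finiteDimensional_of_le h

variable {hV}

theorem HasDisjointLowerEstimate.exists_norm_projFinset_le {p : ℝ} (hp : 0 < p)
    (h : hV.HasDisjointLowerEstimate p) :
    ∃ c : ℝ, 0 < c ∧ ∀ C x, ‖hV.projFinset C x‖ ≤ c * ‖x‖ := by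
  obtain ⟨c, hc, h⟩ := h
  refine ⟨c, hc, fun C x => ?_⟩
  have := h 1 (fun _ => C) (fun k l hkl => absurd (Subsingleton.elim k l) hkl) x
  simpa [Real.rpow_rpow_inv (norm_nonneg _) hp.ne'] using this

theorem HasDisjointLowerEstimate.exists_sum_rpow_le {p : ℝ} (hp : 0 < p)
    (h : hV.HasDisjointLowerEstimate p) :
    ∃ c : ℝ, 0 < c ∧ ∀ (C : ℕ → Finset I), (Pairwise fun k l => Disjoint (C k) (C l)) →
      ∀ (s : Finset ℕ) (x : X), ∑ k ∈ s, ‖hV.projFinset (C k) x‖ ^ p ≤ (c * ‖x‖) ^ p := by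
  obtain ⟨c, hc, h⟩ := h
  refine ⟨c, hc, fun C hC s x => ?_⟩
  have h1 := h s.card (fun k => C (s.equivFin.symm k))
    (fun k l hkl => hC fun e => hkl (s.equivFin.symm.injective (Subtype.ext e))) x
  rw [Equiv.sum_comp s.equivFin.symm (fun k : s => ‖hV.projFinset (C k) x‖ ^ p),
    Finset.sum_coe_sort s (fun k => ‖hV.projFinset (C k) x‖ ^ p)] at h1
  have h0 : 0 ≤ ∑ k ∈ s, ‖hV.projFinset (C k) x‖ ^ p :=
    Finset.sum_nonneg fun k _ => Real.rpow_nonneg (norm_nonneg _) p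
  have h2 := Real.rpow_le_rpow (Real.rpow_nonneg h0 _) h1 hp.le
  rwa [← Real.rpow_mul h0, one_div_mul_cancel hp.ne', Real.rpow_one] at h2

end IsUnconditionalSchauderDecomposition

end Decomposition

/-! ### Tensor products with a finite-rank factor, and block-diagonal sums -/

section FiniteRank

variable {𝕜 : Type*} [RCLike 𝕜]
  {X : Type*} [NormedAddCommGroup X] [NormedSpace 𝕜 X]
  {Y : Type*} [NormedAddCommGroup Y] [NormedSpace 𝕜 Y]

theorem ContinuousLinearMap.exists_eq_sum_smul_of_finiteDimensional_range (T : X →L[𝕜] Y)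
    (hT : FiniteDimensional 𝕜 (LinearMap.range (T : X →ₗ[𝕜] Y))) :
    ∃ (n : ℕ) (f : Fin n → StrongDual 𝕜 X) (e : Fin n → Y), ∀ x, T x = ∑ a, f a x • e a := by
  let R := LinearMap.range (T : X →ₗ[𝕜] Y)
  let b := Module.finBasis 𝕜 R
  let T' : X →L[𝕜] R := T.codRestrict R fun x => ⟨x, rfl⟩
  refine ⟨_, fun a => (LinearMap.toContinuousLinearMap (b.coord a)) ∘L T', fun a => b a,
    fun x => ?_⟩
  have h := congrArg Subtype.val (b.sum_repr (T' x))
  rw [Submodule.coe_sum] at h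
  exact h.symm

namespace ProjectiveTensorProduct

/-- If `S x = ∑ f_a(x) e_a`, then `S ⊗ T` is the sum of the maps `x ⊗ y ↦ f_a(x) T y ↦ e_a ⊗ f_a(x)
T y`, each factoring through `Y`. -/
theorem isSWCGOperator_map_of_finiteDimensional_range_left [CompleteSpace Y]
    (hY : IsSWCG 𝕜 Y) (S : X →L[𝕜] X)
    (hS : FiniteDimensional 𝕜 (LinearMap.range (S : X →ₗ[𝕜] X))) (T : Y →L[𝕜] Y) :
    IsSWCGOperator 𝕜 (map S T) := by
  obtain ⟨n, f, e, h⟩ := S.exists_eq_sum_smul_of_finiteDimensional_range hS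
  have : map S T = ∑ a, mk 𝕜 X Y (e a) ∘L lift ((f a).smulRight T) := by
    refine ext fun x y => ?_
    simp [h]
  rw [this]
  exact IsSWCGOperator.sum _ fun a _ => hY.isSWCGOperator_comp _ _

theorem isSWCGOperator_map_of_finiteDimensional_range_right [CompleteSpace X]
    (hX : IsSWCG 𝕜 X) (S : X →L[𝕜] X)
    (T : Y →L[𝕜] Y) (hT : FiniteDimensional 𝕜 (LinearMap.range (T : Y →ₗ[𝕜] Y))) :
    IsSWCGOperator 𝕜 (map S T) := by
  obtain ⟨n, f, e, h⟩ := T.exists_eq_sum_smul_of_finiteDimensional_range hT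
  have : map S T = ∑ a, (mk 𝕜 X Y).flip (e a) ∘L lift ((f a).smulRight S).flip := by
    refine ext fun x y => ?_
    simp [h]
  rw [this]
  exact IsSWCGOperator.sum _ fun a _ => hX.isSWCGOperator_comp _ _

/-- Unimodular factors `θ k`, depending on `z`, turn the sum into the value at `z` of one functional
`Θ`, whose norm can be estimated on elementary tensors. -/
theorem sum_norm_apply_map_le {S : ℕ → X →L[𝕜] X} {T : ℕ → Y →L[𝕜] Y} {M : ℝ} (hM : 0 ≤ M)
    {s : Finset ℕ} (h : ∀ x y, ∑ k ∈ s, ‖S k x‖ * ‖T k y‖ ≤ M * ‖x‖ * ‖y‖)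
    {φ : ℕ → StrongDual 𝕜 (ProjectiveTensorProduct 𝕜 X Y)} (hφ : ∀ k, ‖φ k‖ ≤ 1)
    (z : ProjectiveTensorProduct 𝕜 X Y) :
    ∑ k ∈ s, ‖(φ k ∘L map (S k) (T k)) z‖ ≤ M * ‖z‖ := by
  have hθ := fun k => RCLike.exists_norm_eq_mul_self ((φ k ∘L map (S k) (T k)) z)
  choose θ hθ1 hθ using hθ
  let Θ : StrongDual 𝕜 (ProjectiveTensorProduct 𝕜 X Y) :=
    ∑ k ∈ s, θ k • (φ k ∘L map (S k) (T k))
  have h1 : Θ z = ((∑ k ∈ s, ‖(φ k ∘L map (S k) (T k)) z‖ : ℝ) : 𝕜) := by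
    simp only [Θ, sum_apply, RCLike.ofReal_sum]
    exact Finset.sum_congr rfl fun k _ => (hθ k).symm
  have h2 : ‖Θ z‖ ≤ M * ‖z‖ := by
    refine norm_apply_le Θ hM (fun x y => ?_) z
    simp only [Θ, sum_apply]
    refine (norm_sum_le _ _).trans ((Finset.sum_le_sum fun k _ => ?_).trans (h x y))
    rw [smul_apply, norm_smul, hθ1, one_mul, ContinuousLinearMap.comp_apply,
      map_mk]
    exact ((φ k).le_of_opNorm_le (hφ k) _).trans (by rw [one_mul]; exact norm_mk_le _ _)
  rw [h1, RCLike.norm_ofReal] at h2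
  exact (le_abs_self _).trans h2

end ProjectiveTensorProduct
end FiniteRank

/-! ### Uniform smallness of the tails -/

section Main
open ProjectiveTensorProduct IsUnconditionalSchauderDecomposition

variable {𝕜 : Type*} [RCLike 𝕜]
  {X : Type*} [NormedAddCommGroup X] [NormedSpace 𝕜 X]
  {Y : Type*} [NormedAddCommGroup Y] [NormedSpace 𝕜 Y]
  {I J : Type*} {V : I → Submodule 𝕜 X} {W : J → Submodule 𝕜 Y}
  {hV : IsUnconditionalSchauderDecomposition V} {hW : IsUnconditionalSchauderDecomposition W}

/-- On a weakly compact subset of `X ⊗ Y`, the part lying outside of finitely many rows and columns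
is uniformly small. -/
theorem IsWeaklyCompact.exists_norm_map_sub_projFinset_le {p q : ℝ} (hp : 1 < p) (hq : 1 < q)
    (hpq : 1 ≤ 1 / p + 1 / q) (hVp : hV.HasDisjointLowerEstimate p)
    (hWq : hW.HasDisjointLowerEstimate q)
    {P : Finset I → X →L[𝕜] X} (hP : ∀ C x, P C x = hV.projFinset C x)
    {Q : Finset J → Y →L[𝕜] Y} (hQ : ∀ D y, Q D y = hW.projFinset D y)
    {K : Set (ProjectiveTensorProduct 𝕜 X Y)} (hK : IsWeaklyCompact 𝕜 K) {ε : ℝ} (hε : 0 < ε) :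
    ∃ C D, ∀ z ∈ K, ‖map (.id 𝕜 X - P C) (.id 𝕜 Y - Q D) z‖ ≤ ε := by
  classical
  by_contra! hcon
  obtain ⟨a, ha, hPa⟩ := hVp.exists_norm_projFinset_le (by linarith)
  obtain ⟨b, hb, hQb⟩ := hWq.exists_norm_projFinset_le (by linarith)
  obtain ⟨c, hc, hPc⟩ := hVp.exists_sum_rpow_le (by linarith)
  obtain ⟨d, hd, hQd⟩ := hWq.exists_sum_rpow_le (by linarith)
  -- Finite projections of the large tail converge to it, so some finite block beyond `C` and `D`
  -- still has norm above `ε`.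
  have hblock : ∀ C D, ∃ A B, Disjoint C A ∧ Disjoint D B ∧ ∃ z ∈ K,
      ε < ‖map (P A) (Q B) z‖ := by
    intro C D
    obtain ⟨z, hz, hzε⟩ := hcon C D
    let u := map (.id 𝕜 X - P C) (.id 𝕜 Y - Q D) z
    have hlim : Tendsto (fun E : Finset I × Finset J =>
        map (P E.1) (Q E.2) u) atTop (𝓝 u) := by
      refine tendsto_map ha.le hb.le (fun E x => by simpa only [hP] using hPa E.1 x)
        (fun E y => by simpa only [hQ] using hQb E.2 y) (fun x => ?_) (fun y => ?_) _
      · simp only [hP, ← prod_atTop_atTop_eq]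
        exact (hV.tendsto_projFinset x).comp tendsto_fst
      · simp only [hQ, ← prod_atTop_atTop_eq]
        exact (hW.tendsto_projFinset y).comp tendsto_snd
    obtain ⟨E, hE⟩ := (hlim.norm.eventually_const_lt hzε).exists
    have hcomp : map (P E.1) (Q E.2) ∘L map (.id 𝕜 X - P C) (.id 𝕜 Y - Q D) =
        map (P (E.1 \ C)) (Q (E.2 \ D)) := by
      refine ProjectiveTensorProduct.ext fun x y => ?_
      simp only [ContinuousLinearMap.comp_apply, map_mk, sub_apply,
        ContinuousLinearMap.id_apply, hP, hQ, projFinset_sub_projFinset]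
    refine ⟨E.1 \ C, E.2 \ D, Finset.disjoint_sdiff, Finset.disjoint_sdiff, z, hz, ?_⟩
    rwa [← hcomp]
  obtain ⟨f, hf, hfr⟩ := exists_seq_of_forall_finset_exists
    (fun A : Finset I × Finset J => ∃ z ∈ K, ε < ‖map (P A.1) (Q A.2) z‖)
    (fun A B => Disjoint A.1 B.1 ∧ Disjoint A.2 B.2) (by
    intro s _
    obtain ⟨A, B, hA, hB, hz⟩ := hblock (s.sup Prod.fst) (s.sup Prod.snd)
    exact ⟨(A, B), hz, fun x hx => ⟨hA.mono_left (Finset.le_sup (f := Prod.fst) hx),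
      hB.mono_left (Finset.le_sup (f := Prod.snd) hx)⟩⟩)
  have hd1 : Pairwise fun k l => Disjoint (f k).1 (f l).1 := fun k l hkl =>
    hkl.lt_or_gt.elim (fun h => (hfr k l h).1) fun h => (hfr l k h).1.symm
  have hd2 : Pairwise fun k l => Disjoint (f k).2 (f l).2 := fun k l hkl =>
    hkl.lt_or_gt.elim (fun h => (hfr k l h).2) fun h => (hfr l k h).2.symm
  choose z hzK hzε using hf
  choose φ hφ hφz using fun k => exists_dual_vector'' 𝕜 (map (P (f k).1) (Q (f k).2) (z k))
  -- The functionals `ψ k` are the coordinates of a bounded operator into `ℓ¹`; the Schur property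
  -- forces one of the values `ψ k (z k)` below `ε`.
  obtain ⟨k, hk⟩ := hK.exists_norm_apply_lt
    (ψ := fun k => φ k ∘L map (P (f k).1) (Q (f k).2)) (C := c * d) (fun w s => by
      refine sum_norm_apply_map_le (mul_nonneg hc.le hd.le) (fun x y => ?_) hφ w
      simp only [hP, hQ]
      refine (sum_mul_le_of_sum_rpow_le hp hq hpq (fun _ => norm_nonneg _) (fun _ => norm_nonneg _)
        (by positivity) (by positivity) (hPc _ hd1 s x) (hQd _ hd2 s y)).trans_eq ?_
      ring) hzK hε
  rw [ContinuousLinearMap.comp_apply, hφz, RCLike.norm_ofReal, abs_norm] at hk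
  exact (hzε k).not_gt hk

end Main

end

theorem theorem1p1 {𝕜 : Type*} [RCLike 𝕜]
    {X : Type*} [NormedAddCommGroup X] [NormedSpace 𝕜 X] [CompleteSpace X]
    {Y : Type*} [NormedAddCommGroup Y] [NormedSpace 𝕜 Y] [CompleteSpace Y]
    (p q : ℝ) (hp : 1 < p) (hq : 1 < q) (hpq : 1 ≤ 1 / p + 1 / q)
    {I : Type*} [Countable I] (V : I → Submodule 𝕜 X)
    (hV : IsUnconditionalSchauderDecomposition V)
    (hVfin : ∀ i, FiniteDimensional 𝕜 (V i))
    (hVp : hV.HasDisjointLowerEstimate p)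
    {J : Type*} [Countable J] (W : J → Submodule 𝕜 Y)
    (hW : IsUnconditionalSchauderDecomposition W)
    (hWfin : ∀ j, FiniteDimensional 𝕜 (W j))
    (hWq : hW.HasDisjointLowerEstimate q)
    (hX : IsSWCG 𝕜 X) (hY : IsSWCG 𝕜 Y) :
    IsSWCG 𝕜 (ProjectiveTensorProduct 𝕜 X Y) := by
  obtain ⟨a, -, hPa⟩ := hVp.exists_norm_projFinset_le (by linarith)
  obtain ⟨b, -, hQb⟩ := hWq.exists_norm_projFinset_le (by linarith)
  let P : Finset I → X →L[𝕜] X := fun C => (hV.projFinset C).mkContinuous a (hPa C)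
  let Q : Finset J → Y →L[𝕜] Y := fun D => (hW.projFinset D).mkContinuous b (hQb D)
  refine isSWCG_of_forall_exists_isSWCGOperator
    (fun E : Finset I × Finset J => ProjectiveTensorProduct.map (P E.1) (.id 𝕜 Y) +
      ProjectiveTensorProduct.map (.id 𝕜 X - P E.1) (Q E.2)) (fun E => ?_) fun K hK ε hε => ?_
  · exact (ProjectiveTensorProduct.isSWCGOperator_map_of_finiteDimensional_range_left hY _
      (hV.finiteDimensional_range_projFinset hVfin E.1) _).add
      (ProjectiveTensorProduct.isSWCGOperator_map_of_finiteDimensional_range_right hX _ _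
        (hW.finiteDimensional_range_projFinset hWfin E.2))
  · obtain ⟨C, D, h⟩ := hK.exists_norm_map_sub_projFinset_le hp hq hpq hVp hWq
      (P := P) (fun _ _ => rfl) (Q := Q) (fun _ _ => rfl) hε
    refine ⟨(C, D), fun z hz => ?_⟩
    -- The error of the approximating operator is exactly the tail in both variables.
    have hid : .id 𝕜 (ProjectiveTensorProduct 𝕜 X Y) -
        (ProjectiveTensorProduct.map (P C) (.id 𝕜 Y) +
          ProjectiveTensorProduct.map (.id 𝕜 X - P C) (Q D)) =
        ProjectiveTensorProduct.map (.id 𝕜 X - P C) (.id 𝕜 Y - Q D) := by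
      refine ProjectiveTensorProduct.ext fun x y => ?_
      simp only [sub_apply, add_apply,
        ProjectiveTensorProduct.map_mk, ContinuousLinearMap.id_apply, map_sub]
      abel
    have := h z hz
    rwa [← hid] at this
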